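/- Let $R$ be a semiring, i.e. $(R,+,0)$ is a commutative monoid, $(R,\cdot,1)$ is a (not necessarily commutative) monoid, multiplication distributes over addition on both sides, and $0r=0=r0$ for all $r\in R$. Left $R$-semimodules are unitary: commutative monoids $M$ with a biadditive, associative action of $R$ satisfying $1m=m$ and $r0=0=0m$. For a left $R$-semimodule $M$, and likewise for $R$ itself, put $$Z(M)=\{m\in M \mid m+x=x \text{ for some } x\in M\}.$$ A right ideal $K$ of $R$ is called right semiregular if for all $i_1,i_2\in K$ there exist $j_1,j_2\in K$ with $$i_1+j_1+i_1j_1+i_2j_2=i_2+j_2+i_1j_2+i_2j_1,$$ and the Jacobson radical $J(R)$ is the sum of all right semiregular right ideals of $R$. A left $R$-semimodule $M$ is called $w$-finitely generated if there exist a natural number $n$ and pairs $(m_1,m_1'),\dots,(m_n,m_n')\in M^2$ such that for every $m\in M$ there exist pairs $(r_1,s_1),\dots,(r_n,s_n)\in R^2$ with $$m+\sum_{k=1}^n (r_km_k'+s_km_k)=\sum_{k=1}^n (r_km_k+s_km_k').$$ For a left ideal $I$ of $R$, $IM$ denotes the set of all finite sums $\sum_k i_kx_k$ with $i_k\in I$,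 $x_k\in M$. **Theorem 4.3 (Nakayama's lemma for semirings).** Suppose that $1\notin Z(R)$, and let $I$ be a left ideal of $R$. Then the following are equivalent: (i) $I\subseteq J(R)$; (ii) for every $w$-finitely generated left $R$-semimodule $M$, if $IM=M$, then $M=Z(M)$. -/

import Mathlib

universe u v

namespace SemiringNakayama

/-- The zeroid `Z(M) = {m | m + x = x for some x}`. It is used both for a semimodule `M` and for
a semiring `R`, since it involves the addition only. -/
def zeroid (M : Type*) [AddCommMonoid M] : Set M :=
  {m | ∃ x : M, m + x = x}

/-- A right ideal `I` of a semiring `R` (a subsemimodule of `R` as a right semimodule over itself)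
is right semiregular if for all `i₁, i₂ ∈ I` there are `j₁, j₂ ∈ I` with
`i₁ + j₁ + i₁ j₁ + i₂ j₂ = i₂ + j₂ + i₁ j₂ + i₂ j₁`. -/
def IsRightSemiregular {R : Type*} [Semiring R] (I : Submodule Rᵐᵒᵖ R) : Prop :=
  ∀ i₁ ∈ I, ∀ i₂ ∈ I, ∃ j₁ ∈ I, ∃ j₂ ∈ I,
    i₁ + j₁ + i₁ * j₁ + i₂ * j₂ = i₂ + j₂ + i₁ * j₂ + i₂ * j₁

/-- The Jacobson(-Bourne) radical `J(R)`: the sum of all right semiregular right ideals. -/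
def jacobsonRadical (R : Type*) [Semiring R] : Submodule Rᵐᵒᵖ R :=
  sSup {I : Submodule Rᵐᵒᵖ R | IsRightSemiregular I}

/-- Weakly finitely generated left semimodules. -/
def IsWFinitelyGenerated (R M : Type*) [Semiring R] [AddCommMonoid M] [Module R M] : Prop :=
  ∃ (n : ℕ) (a b : Fin n → M), ∀ m : M, ∃ r s : Fin n → R,
    m + ∑ k, (r k • b k + s k • a k) = ∑ k, (r k • a k + s k • b k)

end SemiringNakayama

namespace SemiringNakayama

/-! ### Quasi-regularity and the Jacobson radical of a ring -/

section RingJacobson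

variable {S : Type*} [Ring S]

/-! Everything is transported to the ring of differences `S = ℤ ⊗[ℕ] R` and to the group of
differences of `M`, an `S`-module that vanishes exactly when `Z(M) = M`. By
`mem_jacobsonRadical_iff`, `J(R)` is the preimage of the Jacobson radical of `S`, and a `w`-finitely
generated `M` has a finitely generated group of differences, so (i) ⇒ (ii) is the classical Nakayama
lemma. Conversely, if the image of some `i ∈ I` avoids a maximal left ideal `L` of `S`, the simple
module `S ⧸ L`, seen over `R`, contradicts (ii): it is cyclic over `S`, equals its product with `I`,
and has zeroid `{0}`. -/

lemma isUnit_one_add_mul_swap {a b : S} (h : IsUnit (1 + a * b)) : IsUnit (1 + b * a) := by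
  obtain ⟨⟨u, v, huv, hvu⟩, rfl : u = 1 + a * b⟩ := h
  refine ⟨⟨1 + b * a, 1 - b * v * a, ?_, ?_⟩, rfl⟩
  · calc (1 + b * a) * (1 - b * v * a) = 1 + b * a - b * ((1 + a * b) * v) * a := by noncomm_ring
      _ = 1 := by rw [huv]; noncomm_ring
  · calc (1 - b * v * a) * (1 + b * a) = 1 + b * a - b * (v * (1 + a * b)) * a := by noncomm_ring
      _ = 1 := by rw [hvu]; noncomm_ring

lemma mem_ringJacobson_iff_isUnit {x : S} :
    x ∈ Ring.jacobson S ↔ ∀ y, IsUnit (1 + y * x) := by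
  have left_inv : ∀ x ∈ Ring.jacobson S, ∃ z, z * (1 + x) = 1 := fun x hx ↦ by
    rw [← Ideal.jacobson_bot, Ideal.mem_jacobson_iff] at hx
    obtain ⟨z, hz⟩ := hx 1
    refine ⟨z, ?_⟩
    rw [Ideal.mem_bot, sub_eq_zero] at hz
    calc z * (1 + x) = z * 1 * x + z := by noncomm_ring
      _ = 1 := hz
  constructor
  · intro hx y
    have hyx := Ideal.mul_mem_left _ y hx
    obtain ⟨z, hz⟩ := left_inv _ hyx
    -- Since `z = 1 - z * (y * x)`, the left inverse `z` has a left inverse in turn, hence is a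
    -- unit.
    obtain ⟨w, hw⟩ := left_inv (-(z * (y * x)))
      (neg_mem (Ideal.mul_mem_left _ z hyx))
    have hz' : 1 + -(z * (y * x)) = z := by rw [← hz]; noncomm_ring
    rw [hz'] at hw
    have : w = 1 + y * x := by
      calc w = w * (z * (1 + y * x)) := by rw [hz, mul_one]
        _ = 1 + y * x := by rw [← mul_assoc, hw, one_mul]
    exact ⟨⟨1 + y * x, z, this ▸ hw, hz⟩, rfl⟩
  · intro h
    rw [← Ideal.jacobson_bot, Ideal.mem_jacobson_iff]
    intro y
    obtain ⟨⟨u, v, huv, hvu⟩, hu : u = 1 + y * x⟩ := h y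
    refine ⟨v, ?_⟩
    rw [Ideal.mem_bot, sub_eq_zero, ← hvu, hu]; noncomm_ring

/-- A right ideal all of whose elements `x` are such that `1 + x` has a right inverse in `1 + K`
lies in the Jacobson radical. -/
lemma mem_ringJacobson_of_quasiregular {K : Set S} (hmul : ∀ x ∈ K, ∀ s, x * s ∈ K)
    (hK : ∀ x ∈ K, ∃ y ∈ K, (1 + x) * (1 + y) = 1) {x : S} (hx : x ∈ K) :
    x ∈ Ring.jacobson S := by
  rw [mem_ringJacobson_iff_isUnit]
  intro s
  refine isUnit_one_add_mul_swap ?_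
  obtain ⟨y, hy, hxy⟩ := hK _ (hmul x hx s)
  obtain ⟨z, -, hyz⟩ := hK y hy
  have : 1 + z = 1 + x * s := by
    calc 1 + z = ((1 + x * s) * (1 + y)) * (1 + z) := by rw [hxy, one_mul]
      _ = 1 + x * s := by rw [mul_assoc, hyz, mul_one]
  exact ⟨⟨1 + x * s, 1 + y, hxy, this ▸ hyz⟩, rfl⟩

end RingJacobson

/-- `φ : R → S` exhibits the ring `S` as the ring of differences of the semiring `R`. -/
structure IsDifferenceRing {R S : Type*} [Semiring R] [Ring S] (φ : R →+* S) : Prop where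
  exists_sub : ∀ s, ∃ a b, s = φ a - φ b
  exists_add_eq : ∀ {a b}, φ a = φ b → ∃ c, a + c = b + c

/-! ### `J(R)` as a preimage -/

section JacobsonRadical

variable {R S : Type*} [Semiring R] [Ring S] {φ : R →+* S}

/-- Differences of elements of `φ(K)` form a right ideal of `S`, and semiregularity of `K` is the
equation `(1 + x)(1 + y) = 1` there, written without subtraction. -/
lemma IsRightSemiregular.map_mem_ringJacobson (hφ : IsDifferenceRing φ)
    {K : Submodule Rᵐᵒᵖ R} (hK : IsRightSemiregular K) {x : R} (hx : x ∈ K) :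
    φ x ∈ Ring.jacobson S := by
  have hmem : ∀ {x}, x ∈ K → ∀ r, x * r ∈ K := fun hx r ↦ K.smul_mem (MulOpposite.op r) hx
  refine mem_ringJacobson_of_quasiregular
    (K := {s | ∃ a ∈ K, ∃ b ∈ K, s = φ a - φ b}) ?_ ?_ ⟨x, hx, 0, K.zero_mem, by simp⟩
  · rintro _ ⟨a, ha, b, hb, rfl⟩ s
    obtain ⟨c, d, rfl⟩ := hφ.exists_sub s
    refine ⟨a * c + b * d, K.add_mem (hmem ha c) (hmem hb d),
      a * d + b * c, K.add_mem (hmem ha d) (hmem hb c), ?_⟩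
    simp only [map_add, map_mul]; noncomm_ring
  · rintro _ ⟨a, ha, b, hb, rfl⟩
    obtain ⟨c, hc, d, hd, h⟩ := hK a ha b hb
    refine ⟨φ c - φ d, ⟨c, hc, d, hd, rfl⟩, ?_⟩
    have h := congrArg φ h
    simp only [map_add, map_mul] at h
    rw [← sub_eq_zero] at h ⊢
    rw [← h]; noncomm_ring

/-- The preimage of the Jacobson radical of the ring of differences, as a right ideal. -/
def comapJacobson (φ : R →+* S) : Submodule Rᵐᵒᵖ R where
  carrier := {x | φ x ∈ Ring.jacobson S}
  add_mem' {a b} ha hb := by simpa using add_mem ha hb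
  zero_mem' := by simp
  smul_mem' r x hx := by
    simpa using Ideal.mul_mem_right (φ r.unop) (Ring.jacobson S) hx

lemma isRightSemiregular_comapJacobson (hφ : IsDifferenceRing φ) :
    IsRightSemiregular (comapJacobson φ) := by
  intro i₁ h₁ i₂ h₂
  have hmem : ∀ {x}, x ∈ comapJacobson φ → ∀ r, x * r ∈ comapJacobson φ :=
    fun hx r ↦ (comapJacobson φ).smul_mem (MulOpposite.op r) hx
  have hx : φ i₁ - φ i₂ ∈ Ring.jacobson S := sub_mem h₁ h₂
  obtain ⟨u, hu⟩ := mem_ringJacobson_iff_isUnit.1 hx 1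
  rw [one_mul] at hu
  obtain ⟨a, b, hab⟩ := hφ.exists_sub (↑u⁻¹ - 1)
  have hinv : (1 + (φ i₁ - φ i₂)) * (1 + (φ a - φ b)) = 1 := by
    rw [← hab, ← hu, add_sub_cancel, Units.mul_inv]
  obtain ⟨c, hc⟩ : ∃ c, (a + (i₁ + i₁ * a + i₂ * b)) + c = (b + (i₂ + i₁ * b + i₂ * a)) + c := by
    refine hφ.exists_add_eq ?_
    simp only [map_add, map_mul]
    rw [← sub_eq_zero] at hinv ⊢
    rw [← hinv]; noncomm_ring
  -- With `x = φ i₁ - φ i₂` and `y = φ a - φ b`, the inverse equation reads `y = -x - x * y`.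
  -- Expanding the right side gives witnesses in the ideal, although `a` and `b` need not be. The
  -- common summand `i₁ * c + i₂ * c` makes `hc` applicable, so the identity holds in `R` itself.
  refine ⟨i₂ + i₁ * b + i₂ * a + (i₁ * c + i₂ * c), ?_,
    i₁ + i₁ * a + i₂ * b + (i₁ * c + i₂ * c), ?_, ?_⟩
  · exact add_mem (add_mem (add_mem h₂ (hmem h₁ b)) (hmem h₂ a))
      (add_mem (hmem h₁ c) (hmem h₂ c))
  · exact add_mem (add_mem (add_mem h₁ (hmem h₁ a)) (hmem h₂ b))
      (add_mem (hmem h₁ c) (hmem h₂ c))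
  · set p := a + (i₁ + i₁ * a + i₂ * b) with hp
    set q := b + (i₂ + i₁ * b + i₂ * a) with hq
    set d := i₁ * c + i₂ * c with hd
    calc _ = i₁ + i₂ + i₁ * (q + c) + i₂ * (p + c) + i₁ * d + i₂ * d := by
          simp only [hp, hq, hd, mul_add]; abel
      _ = i₁ + i₂ + i₁ * (p + c) + i₂ * (q + c) + i₁ * d + i₂ * d := by rw [hc]
      _ = _ := by simp only [hp, hq, hd, mul_add]; abel

theorem mem_jacobsonRadical_iff (hφ : IsDifferenceRing φ) {x : R} :
    x ∈ jacobsonRadical R ↔ φ x ∈ Ring.jacobson S := by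
  refine ⟨fun h ↦ ?_, fun h ↦ ?_⟩
  · have : jacobsonRadical R ≤ comapJacobson φ :=
      sSup_le fun K hK x hx ↦ IsRightSemiregular.map_mem_ringJacobson hφ hK hx
    exact this h
  · exact (le_sSup (isRightSemiregular_comapJacobson hφ) : _ ≤ jacobsonRadical R) h

end JacobsonRadical

/-! ### The group of differences of a semimodule -/

section GrothendieckModule

open Algebra

variable {R M : Type*} [Semiring R] [AddCommMonoid M] [Module R M]

lemma grothendieck_exists_sub (g : GrothendieckAddGroup M) :
    ∃ a b, g = GrothendieckAddGroup.of a - GrothendieckAddGroup.of b := by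
  induction g using AddLocalization.ind with
  | _ y =>
    refine ⟨y.1, y.2, ?_⟩
    simp only [GrothendieckAddGroup.of, AddSubmonoid.LocalizationMap.toAddMonoidHom_apply,
      ← AddLocalization.mk_zero_eq_addMonoidOf_mk]
    rw [GrothendieckAddGroup.mk_sub_mk]
    simp

lemma grothendieck_of_eq_iff {a b : M} :
    GrothendieckAddGroup.of a = GrothendieckAddGroup.of b ↔ ∃ c, a + c = b + c := by
  simp only [GrothendieckAddGroup.of, AddSubmonoid.LocalizationMap.toAddMonoidHom_apply]
  rw [(AddLocalization.addMonoidOf (⊤ : AddSubmonoid M)).eq_iff_exists]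
  simp [add_comm]

lemma grothendieck_lift_of {G : Type*} [AddCommGroup G] (f : M →+ G) (m : M) :
    GrothendieckAddGroup.lift f (GrothendieckAddGroup.of m) = f m :=
  DFunLike.congr_fun (GrothendieckAddGroup.lift.symm_apply_apply f) m

lemma grothendieck_end_ext {f g : AddMonoid.End (GrothendieckAddGroup M)}
    (h : ∀ m : M, f (GrothendieckAddGroup.of m) = g (GrothendieckAddGroup.of m)) : f = g := by
  ext x
  obtain ⟨a, b, rfl⟩ := grothendieck_exists_sub x
  rw [map_sub, map_sub, h, h]

/-- The endomorphism of the group of differences of `M` induced by the action of `r`. -/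
noncomputable def grothendieckSMul (M : Type*) [AddCommMonoid M] [Module R M] (r : R) :
    AddMonoid.End (GrothendieckAddGroup M) :=
  GrothendieckAddGroup.lift
    ((GrothendieckAddGroup.of (M := M)).comp (DistribSMul.toAddMonoidHom M r))

lemma grothendieckSMul_of (r : R) (m : M) :
    grothendieckSMul M r (GrothendieckAddGroup.of m) = GrothendieckAddGroup.of (r • m) :=
  grothendieck_lift_of _ m

/-- The action of `R` on the group of differences of `M`. -/
noncomputable def grothendieckAction (R M : Type*) [Semiring R] [AddCommMonoid M] [Module R M] :
    R →+* AddMonoid.End (GrothendieckAddGroup M) where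
  toFun := grothendieckSMul M
  map_one' := grothendieck_end_ext fun m ↦ by
    rw [grothendieckSMul_of, one_smul]; rfl
  map_zero' := grothendieck_end_ext fun m ↦ by
    rw [grothendieckSMul_of, zero_smul, map_zero]; rfl
  map_add' r s := grothendieck_end_ext fun m ↦ by
    change _ = grothendieckSMul M r _ + grothendieckSMul M s _
    simp only [grothendieckSMul_of, add_smul, map_add]
  map_mul' r s := grothendieck_end_ext fun m ↦ by
    change _ = grothendieckSMul M r (grothendieckSMul M s _)
    simp only [grothendieckSMul_of, mul_smul]

noncomputable instance grothendieckModule : Module R (GrothendieckAddGroup M) :=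
  Module.compHom _ (grothendieckAction R M)

lemma grothendieck_smul_of (r : R) (m : M) :
    r • (GrothendieckAddGroup.of m : GrothendieckAddGroup M) = GrothendieckAddGroup.of (r • m) :=
  grothendieckSMul_of r m

end GrothendieckModule

/-! ### The ring of differences, and (i) ⇒ (ii) -/

section DifferenceRing

open Algebra TensorProduct

attribute [local instance] TensorProduct.Algebra.module

variable (R : Type*) [Semiring R]

/-- The canonical map from a semiring to its ring of differences, realised as `ℤ ⊗[ℕ] R`. -/
noncomputable def toDifferenceRing : R →+* ℤ ⊗[ℕ] R :=
  (Algebra.TensorProduct.includeRight : R →ₐ[ℕ] ℤ ⊗[ℕ] R).toRingHom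

variable {R}

lemma toDifferenceRing_smul {G : Type*} [AddCommGroup G] [Module R G] (r : R) (g : G) :
    toDifferenceRing R r • g = r • g := by
  change ((1 : ℤ) ⊗ₜ[ℕ] r) • g = _
  rw [TensorProduct.Algebra.smul_def, one_smul]

variable (R) in
lemma isDifferenceRing_toDifferenceRing : IsDifferenceRing (toDifferenceRing R) where
  exists_sub s := by
    induction s using TensorProduct.induction_on with
    | zero => exact ⟨0, 0, by simp⟩
    | tmul z r =>
      have key : ∀ n : ℕ, ((n : ℤ) ⊗ₜ[ℕ] r : ℤ ⊗[ℕ] R) = toDifferenceRing R (n • r) := fun n ↦ by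
        change _ = (1 : ℤ) ⊗ₜ[ℕ] (n • r)
        rw [← TensorProduct.smul_tmul]; simp
      obtain ⟨n, rfl | rfl⟩ := z.eq_nat_or_neg
      · exact ⟨n • r, 0, by rw [key]; simp⟩
      · exact ⟨0, n • r, by rw [TensorProduct.neg_tmul, key]; simp⟩
    | add x y hx hy =>
      obtain ⟨a, b, rfl⟩ := hx
      obtain ⟨c, d, rfl⟩ := hy
      exact ⟨a + c, b + d, by simp only [map_add]; abel⟩
  exists_add_eq {a b} h := by
    -- Acting on the class of `1` in the group of differences of `R` recovers the class of `a` from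
    -- its image in the tensor product.
    have h := congrArg (· • (GrothendieckAddGroup.of 1 : GrothendieckAddGroup R)) h
    simp only [toDifferenceRing_smul, grothendieck_smul_of, smul_eq_mul, mul_one] at h
    exact grothendieck_of_eq_iff.1 h

theorem zeroid_eq_univ_of_le_jacobsonRadical {M : Type*} [AddCommMonoid M] [Module R M]
    {I : Ideal R} (hI : (I : Set R) ⊆ jacobsonRadical R) (hM : IsWFinitelyGenerated R M)
    (hIM : I • (⊤ : Submodule R M) = ⊤) : zeroid M = Set.univ := by
  let of := GrothendieckAddGroup.of (M := M)
  let S := ℤ ⊗[ℕ] R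
  obtain ⟨n, a, b, hab⟩ := hM
  have hsmul (r : R) (m : M) : of (r • m) = toDifferenceRing R r • of m := by
    rw [toDifferenceRing_smul, grothendieck_smul_of]
  have htop : (⊤ : Submodule S (GrothendieckAddGroup M)) ≤
      Submodule.span S (Set.range fun k ↦ of (a k) - of (b k)) := by
    have hof (m : M) : of m ∈ Submodule.span S (Set.range fun k ↦ of (a k) - of (b k)) := by
      obtain ⟨r, s, h⟩ := hab m
      have h := congrArg of h
      have hm : of m = ∑ k, (toDifferenceRing R (r k) - toDifferenceRing R (s k)) •
          (of (a k) - of (b k)) := by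
        simp only [map_add, map_sum, hsmul] at h
        rw [← eq_sub_iff_add_eq, ← Finset.sum_sub_distrib] at h
        rw [h]
        refine Finset.sum_congr rfl fun k _ ↦ ?_
        rw [sub_smul, smul_sub, smul_sub]; abel
      rw [hm]
      exact Submodule.sum_mem _ fun k _ ↦ Submodule.smul_mem _ _ (Submodule.subset_span ⟨k, rfl⟩)
    intro g _
    obtain ⟨x, y, rfl⟩ := grothendieck_exists_sub g
    exact sub_mem (hof x) (hof y)
  have hfg : (⊤ : Submodule S (GrothendieckAddGroup M)).FG := by
    rw [top_le_iff] at htop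
    rw [← htop]
    exact Submodule.fg_span (Set.finite_range _)
  have hJ : (⊤ : Submodule S (GrothendieckAddGroup M)) ≤ Ring.jacobson S • ⊤ := by
    have hof (m : M) : of m ∈ Ring.jacobson S • (⊤ : Submodule S (GrothendieckAddGroup M)) := by
      have hm : m ∈ I • (⊤ : Submodule R M) := by rw [hIM]; trivial
      induction hm using Submodule.smul_induction_on' with
      | smul r hr m _ =>
        rw [hsmul]
        exact Submodule.smul_mem_smul
          ((mem_jacobsonRadical_iff (isDifferenceRing_toDifferenceRing R)).1 (hI hr)) trivial
      | add x _ y _ hx hy => rw [map_add]; exact add_mem hx hy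
    intro g _
    obtain ⟨x, y, rfl⟩ := grothendieck_exists_sub g
    exact sub_mem (hof x) (hof y)
  have hbot := hfg.eq_bot_of_le_jacobson_smul hJ
  refine Set.eq_univ_of_forall fun m ↦ ?_
  have hm : of m = of 0 := by
    rw [map_zero, ← Submodule.mem_bot S, ← hbot]
    trivial
  obtain ⟨c, hc⟩ := grothendieck_of_eq_iff.1 hm
  exact ⟨c, by rw [hc, zero_add]⟩

end DifferenceRing

/-! ### Simple modules over the ring of differences -/

section Simple

variable {R S Q : Type*} [Semiring R] [Ring S] {φ : R →+* S} [AddCommGroup Q] [Module R Q]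
  [Module S Q]

lemma zeroid_eq_singleton (G : Type*) [AddCommGroup G] : zeroid G = {0} := by
  ext; simp [zeroid]

/-- `I • ⊤` is closed under negation because `-(r • m) = r • (-m)`. It is therefore an
`S`-submodule, nonzero by `hq`, and simplicity applies. -/
lemma smul_top_eq_top_of_isSimpleModule [IsSimpleModule S Q] (hφ : IsDifferenceRing φ)
    (hsmul : ∀ (r : R) (q : Q), φ r • q = r • q) {I : Ideal R} {i : R} (hi : i ∈ I) {q : Q}
    (hq : i • q ≠ 0) : I • (⊤ : Submodule R Q) = ⊤ := by
  have hneg (x : Q) (hx : x ∈ I • (⊤ : Submodule R Q)) : -x ∈ I • (⊤ : Submodule R Q) := by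
    induction hx using Submodule.smul_induction_on' with
    | smul r hr m _ =>
      rw [← hsmul, ← smul_neg, hsmul]
      exact Submodule.smul_mem_smul hr trivial
    | add x _ y _ hx hy => rw [neg_add]; exact add_mem hx hy
  let N : Submodule S Q :=
    { carrier := (I • (⊤ : Submodule R Q) : Submodule R Q)
      add_mem' := add_mem
      zero_mem' := zero_mem _
      smul_mem' := fun s x hx ↦ by
        obtain ⟨a, b, rfl⟩ := hφ.exists_sub s
        rw [sub_smul, hsmul, hsmul, sub_eq_add_neg]
        exact add_mem (Submodule.smul_mem _ _ hx) (hneg _ (Submodule.smul_mem _ _ hx)) }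
  have hN : N = ⊤ := (eq_bot_or_eq_top N).resolve_left fun h ↦ hq <| by
    rw [← Submodule.mem_bot S, ← h]
    exact (Submodule.smul_mem_smul hi trivial : i • q ∈ I • (⊤ : Submodule R Q))
  refine top_le_iff.1 fun x _ ↦ ?_
  have hx : x ∈ N := hN ▸ Submodule.mem_top
  exact hx

lemma isWFinitelyGenerated_of_span_singleton (hφ : IsDifferenceRing φ)
    (hsmul : ∀ (r : R) (q : Q), φ r • q = r • q) {q : Q} (hq : ∀ x, ∃ s : S, s • q = x) :
    IsWFinitelyGenerated R Q := by
  -- For the pair `(q, 0)` the condition reads `x + b • q = a • q`, that is, `x = (φ a - φ b) • q`.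
  refine ⟨1, fun _ ↦ q, fun _ ↦ 0, fun x ↦ ?_⟩
  obtain ⟨s, rfl⟩ := hq x
  obtain ⟨a, b, rfl⟩ := hφ.exists_sub s
  exact ⟨fun _ ↦ a, fun _ ↦ b, by simp [sub_smul, hsmul]⟩

end Simple

end SemiringNakayama

theorem theorem4p3 {R : Type u} [Semiring R]
    (h1 : (1 : R) ∉ SemiringNakayama.zeroid R) (I : Ideal R) :
    (I : Set R) ⊆ (SemiringNakayama.jacobsonRadical R : Set R) ↔
      ∀ (M : Type (max u v)) [AddCommMonoid M] [Module R M],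
        SemiringNakayama.IsWFinitelyGenerated R M →
        I • (⊤ : Submodule R M) = ⊤ →
        SemiringNakayama.zeroid M = Set.univ := by
  refine ⟨fun hI M _ _ ↦ SemiringNakayama.zeroid_eq_univ_of_le_jacobsonRadical hI,
    fun H i hi ↦ ?_⟩
  let φ := SemiringNakayama.toDifferenceRing R
  have hφ := SemiringNakayama.isDifferenceRing_toDifferenceRing R
  change i ∈ SemiringNakayama.jacobsonRadical R
  rw [SemiringNakayama.mem_jacobsonRadical_iff hφ, Ring.jacobson_eq_sInf_isMaximal,
    Submodule.mem_sInf]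
  intro L (hL : Ideal.IsMaximal L)
  by_contra hiL
  let S := TensorProduct ℕ ℤ R
  let Q : Type (max u v) := ULift.{v} (S ⧸ L)
  let e : Q ≃ₗ[S] (S ⧸ L) := ULift.moduleEquiv
  have : IsSimpleModule S (S ⧸ L) := isSimpleModule_iff_isCoatom.2 hL.out
  have : IsSimpleModule S Q := IsSimpleModule.congr e
  let _ : Module R Q := Module.compHom Q φ
  have hsmul (r : R) (q : Q) : φ r • q = r • q := rfl
  let q : Q := ULift.up (Submodule.Quotient.mk 1)
  have hq : i • q ≠ 0 := fun h ↦ hiL <| by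
    have h : e (φ i • q) = 0 := by rw [hsmul, h, map_zero]
    rw [map_smul] at h
    change φ i • (Submodule.Quotient.mk 1 : S ⧸ L) = 0 at h
    rwa [← Submodule.Quotient.mk_smul, smul_eq_mul, mul_one, Submodule.Quotient.mk_eq_zero] at h
  have hgen (x : Q) : ∃ s : S, s • q = x := by
    obtain ⟨x⟩ := x
    obtain ⟨s, rfl⟩ := Submodule.Quotient.mk_surjective L x
    refine ⟨s, e.injective ?_⟩
    rw [map_smul]
    change s • (Submodule.Quotient.mk 1 : S ⧸ L) = Submodule.Quotient.mk s
    rw [← Submodule.Quotient.mk_smul, smul_eq_mul, mul_one]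
  have hZ := H Q (SemiringNakayama.isWFinitelyGenerated_of_span_singleton hφ hsmul hgen)
    (SemiringNakayama.smul_top_eq_top_of_isSimpleModule hφ hsmul hi hq)
  rw [SemiringNakayama.zeroid_eq_singleton] at hZ
  exact hq (hZ ▸ Set.mem_univ (i • q) : i • q ∈ ({0} : Set Q))
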